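/- Conventions. A Bratteli diagram $(V,E)$ has finite vertex sets $V_0=\{v_0\},V_1,V_2,\ldots$ and finite edge sets $E_1,E_2,\ldots$, where an edge $e\in E_n$ goes from its source $\mathsf s(e)\in V_{n-1}$ to its range $\mathsf r(e)\in V_n$; every vertex is the source of some edge, and every vertex other than $v_0$ is the range of some edge. $M_n$ is the $V_{n-1}\times V_n$ incidence matrix, whose $(u,v)$ entry is the number of edges from $u$ to $v$, and $h_n=M_1\cdots M_n=(h_n(v))_{v\in V_n}$, so that $h_n(v)$ is the number of paths from $v_0$ to $v$. An ordered Bratteli diagram $B=(V,E,\preceq)$ carries a partial order on $E$ in which two edges are comparable if and only if they have the same range. $X_B$ is the space of infinite paths from $v_0$, with the topology generated by the cylinder sets. If $B$ is properly ordered (there is a unique infinite path $x_{\max}$ of maximal edges and a unique infinite path $x_{\min}$ of minimal edges), the Vershik map $V_B:X_B\to X_B$ sends $x_{\max}$ to $x_{\min}$, and sends $x\neq x_{\max}$ to the path obtained by replacing the first non-maximal edge $x_n$ of $x$ by its successor and $(x_1,\ldots,x_{n-1})$ by the minimal path from $v_0$ to the source of that successor. $B$ is a proper Bratteli–Vershik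 representation if it is properly ordered, all entries of $h_1$ are $1$, and for every $n\ge 2$ all entries of $M_n$ are positive and all maximal edges of $E_n$ start in the same vertex. A complex number $\lambda$ is a continuous eigenvalue of $(X_B,V_B)$ if $f\circ V_B=\lambda f$ for some continuous $f:X_B\to\mathbb C$, $f\neq 0$. For a real vector $a=(a(v))_v$, $|\!|\!|a|\!|\!|=\max_v \mathrm{dist}(a(v),\mathbb Z)$. Let $(\omega_n)_{n\ge 2}$ be a sequence of positive integers. An $(\omega_n;n\ge2)$-order modification of $B=(V,E,\preceq)$ is an ordered Bratteli diagram $B'=(V,E,\preceq')$ on the same diagram such that, for every $n\ge 2$ and every $v\in V_n$, the local orders at $v$ differ at most $\omega_n$ times: $\preceq'$ is obtained from $\preceq$ on $\mathsf r^{-1}(v)$ by moving at most $\omega_n$ edges, i.e. $\preceq$ and $\preceq'$ coincide on $\mathsf r^{-1}(v)\setminus F$ for some set $F$ of at most $\omega_n$ edges. Statement. Let $B=(V,E,\preceq)$ be a proper Bratteli–Vershik representation, let $\alpha\in\mathbb R$ be such that $\lambda=\exp(2i\pi\alpha)$ is a continuous eigenvalue of $(X_B,V_B)$, and let $(\omega_n)_{n\geq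 2}$ be a sequence of positive integers such that $\sum_{n\ge 2}\omega_{n+1}\,|\!|\!|\alpha h_n|\!|\!|<\infty$. Then $\lambda$ is a continuous eigenvalue of $(X_{B'},V_{B'})$ for every proper $(\omega_n;n\ge 2)$-order modification $B'$ of $B$. -/

import Mathlib

universe u v

/-- A Bratteli diagram. The type `E n` is the set `E_{n+1}` of edges from level `n` to level
`n + 1`; `s` and `r` are the source and range maps. -/
structure BratteliDiagram where
  V : ℕ → Type u
  E : ℕ → Type v
  [fintypeV : ∀ n, Fintype (V n)]
  [fintypeE : ∀ n, Fintype (E n)]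
  s : ∀ {n : ℕ}, E n → V n
  r : ∀ {n : ℕ}, E n → V (n + 1)
  root : V 0
  eq_root : ∀ w : V 0, w = root
  s_surjective : ∀ n, Function.Surjective (s : E n → V n)
  r_surjective : ∀ n, Function.Surjective (r : E n → V (n + 1))

namespace BratteliDiagram

attribute [instance] BratteliDiagram.fintypeV BratteliDiagram.fintypeE

/-- The incidence matrix `M_{n+1}`: its `(u, w)` entry is the number of edges from `u ∈ V_n`
to `w ∈ V_{n+1}`. -/
noncomputable def incidence (B : BratteliDiagram.{u, v}) (n : ℕ) :
    Matrix (B.V n) (B.V (n + 1)) ℕ :=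
  fun u w => Nat.card {e : B.E n // B.s e = u ∧ B.r e = w}

/-- The height row vectors: `h_0 = (1)` and `h_{n+1} = h_n M_{n+1}`, so that `h_n(w)` is the
number of paths from the root to `w`. -/
noncomputable def height (B : BratteliDiagram.{u, v}) : (n : ℕ) → B.V n → ℕ
  | 0 => fun _ => 1
  | n + 1 => Matrix.vecMul (B.height n) (B.incidence n)

/-- The space `X_B` of infinite paths `(x_1, x_2, …)` starting at the root; `x n` is the
edge `x_{n+1}`. -/
def PathSpace (B : BratteliDiagram.{u, v}) : Type v :=
  {x : ∀ n, B.E n // ∀ n, B.r (x n) = B.s (x (n + 1))}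

/-- The topology generated by the cylinder sets: the one induced by the product of the discrete
topologies on the finite sets of edges. -/
instance (B : BratteliDiagram.{u, v}) : TopologicalSpace B.PathSpace :=
  TopologicalSpace.induced (fun x : B.PathSpace => x.1)
    (@Pi.topologicalSpace ℕ B.E (fun _ => ⊥))

/-- A partial order on the edges for which two edges are comparable if and only if they have
the same range. (Edges of different levels have different ranges, so the order is given level by
level.) Together with such an order, a Bratteli diagram is an ordered Bratteli diagram. -/
structure EdgeOrder (B : BratteliDiagram.{u, v}) where
  le : ∀ {n : ℕ}, B.E n → B.E n → Prop
  le_refl : ∀ {n : ℕ} (e : B.E n), le e e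
  le_trans : ∀ {n : ℕ} (e f g : B.E n), le e f → le f g → le e g
  le_antisymm : ∀ {n : ℕ} (e f : B.E n), le e f → le f e → e = f
  comparable_iff : ∀ {n : ℕ} (e f : B.E n), (le e f ∨ le f e) ↔ B.r e = B.r f

namespace EdgeOrder

variable {B : BratteliDiagram.{u, v}}

def IsMaxEdge (o : B.EdgeOrder) {n : ℕ} (e : B.E n) : Prop := ∀ f : B.E n, o.le e f → f = e

def IsMinEdge (o : B.EdgeOrder) {n : ℕ} (e : B.E n) : Prop := ∀ f : B.E n, o.le f e → f = e

/-- `f` is the successor of `e` for the local order. -/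
def IsSucc (o : B.EdgeOrder) {n : ℕ} (e f : B.E n) : Prop :=
  o.le e f ∧ e ≠ f ∧ ∀ g : B.E n, o.le e g → e ≠ g → o.le f g

/-- `x` is a path all of whose edges are maximal. -/
def IsMaxPath (o : B.EdgeOrder) (x : B.PathSpace) : Prop := ∀ n, o.IsMaxEdge (x.1 n)

/-- `x` is a path all of whose edges are minimal. -/
def IsMinPath (o : B.EdgeOrder) (x : B.PathSpace) : Prop := ∀ n, o.IsMinEdge (x.1 n)

/-- There is exactly one maximal infinite path and exactly one minimal infinite path. -/
def IsProperlyOrdered (o : B.EdgeOrder) : Prop :=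
  (∃! x, o.IsMaxPath x) ∧ (∃! x, o.IsMinPath x)

/-- The graph of the Vershik map. If `x` is not the maximal path and `x_n` is its first
non-maximal edge, then `y_n` is the successor of `x_n`, the edges of `y` before `y_n` are minimal,
and the edges of `y` after `y_n` are those of `x`; the maximal path is sent to the minimal one. -/
def VershikRel (o : B.EdgeOrder) (x y : B.PathSpace) : Prop :=
  (o.IsMaxPath x ∧ o.IsMinPath y) ∨
  ∃ n, (∀ i, i < n → o.IsMaxEdge (x.1 i)) ∧ ¬ o.IsMaxEdge (x.1 n) ∧
    (∀ i, i < n → o.IsMinEdge (y.1 i)) ∧ o.IsSucc (x.1 n) (y.1 n) ∧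
    ∀ i, n < i → y.1 i = x.1 i

theorem r_eq_of_le (o : B.EdgeOrder) {n : ℕ} {e f : B.E n} (h : o.le e f) : B.r e = B.r f :=
  (o.comparable_iff e f).1 (Or.inl h)

/-- Every nonempty set of edges with a common range has a least element. -/
theorem exists_least (o : B.EdgeOrder) {n : ℕ} (w : B.V (n + 1)) (S : Set (B.E n))
    (hS : S.Nonempty) (hw : ∀ e ∈ S, B.r e = w) : ∃ e ∈ S, ∀ f ∈ S, o.le e f := by
  let _ : PartialOrder (B.E n) :=
    { le := o.le, le_refl := o.le_refl, le_trans := o.le_trans, le_antisymm := o.le_antisymm }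
  obtain ⟨e, he⟩ := S.toFinite.exists_minimal hS
  refine ⟨e, he.1, fun f hf => ?_⟩
  rcases (o.comparable_iff e f).2 ((hw e he.1).trans (hw f hf).symm) with h | h
  · exact h
  · exact he.2 hf h

theorem exists_isMinEdge (o : B.EdgeOrder) {n : ℕ} (w : B.V (n + 1)) :
    ∃ e : B.E n, B.r e = w ∧ o.IsMinEdge e := by
  obtain ⟨e, he, hle⟩ := o.exists_least w {e | B.r e = w} (B.r_surjective n w) (fun _ h => h)
  exact ⟨e, he, fun f hf => o.le_antisymm f e hf (hle f ((o.r_eq_of_le hf).trans he))⟩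

theorem isMinEdge_unique (o : B.EdgeOrder) {n : ℕ} {e f : B.E n} (he : o.IsMinEdge e)
    (hf : o.IsMinEdge f) (h : B.r e = B.r f) : e = f := by
  rcases (o.comparable_iff e f).2 h with h | h
  · exact hf e h
  · exact (he f h).symm

theorem exists_isSucc (o : B.EdgeOrder) {n : ℕ} {e : B.E n} (he : ¬ o.IsMaxEdge e) :
    ∃ f : B.E n, o.IsSucc e f := by
  unfold IsMaxEdge at he
  push Not at he
  obtain ⟨g, hg, hne⟩ := he
  obtain ⟨f, hf, hle⟩ := o.exists_least (B.r e) {f | o.le e f ∧ e ≠ f} ⟨g, hg, hne.symm⟩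
    (fun f hf => (o.r_eq_of_le hf.1).symm)
  exact ⟨f, hf.1, hf.2, fun g h1 h2 => hle g ⟨h1, h2⟩⟩

theorem isSucc_unique (o : B.EdgeOrder) {n : ℕ} {e f g : B.E n} (hf : o.IsSucc e f)
    (hg : o.IsSucc e g) : f = g :=
  o.le_antisymm f g (hf.2.2 g hg.1 hg.2.1) (hg.2.2 f hf.1 hf.2.1)

/-- Any tail of a path can be completed by minimal edges down to the root. -/
theorem exists_min_completion (o : B.EdgeOrder) (n : ℕ) (z : ∀ i, B.E i)
    (hz : ∀ i, n ≤ i → B.r (z i) = B.s (z (i + 1))) :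
    ∃ y : B.PathSpace, (∀ i, i < n → o.IsMinEdge (y.1 i)) ∧ ∀ i, n ≤ i → y.1 i = z i := by
  classical
  induction n generalizing z with
  | zero => exact ⟨⟨z, fun i => hz i (Nat.zero_le i)⟩, fun i hi => by omega, fun i _ => rfl⟩
  | succ n ih =>
    obtain ⟨e, he, hmin⟩ := o.exists_isMinEdge (B.s (z (n + 1)))
    obtain ⟨y, hy1, hy2⟩ := ih (Function.update z n e) (by
      intro i hi
      rcases Nat.eq_or_lt_of_le hi with rfl | hlt
      · simpa using he
      · rw [Function.update_of_ne (by omega), Function.update_of_ne (by omega)]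
        exact hz i hlt)
    refine ⟨y, fun i hi => ?_, fun i hi => ?_⟩
    · rcases Nat.lt_succ_iff_lt_or_eq.1 hi with h | rfl
      · exact hy1 i h
      · rw [hy2 i le_rfl]
        simpa using hmin
    · rw [hy2 i (by omega), Function.update_of_ne (by omega)]

theorem existsUnique_vershikRel (o : B.EdgeOrder) (ho : o.IsProperlyOrdered) (x : B.PathSpace) :
    ∃! y, o.VershikRel x y := by
  classical
  by_cases hx : o.IsMaxPath x
  · obtain ⟨y, hy, hyu⟩ := ho.2
    refine ⟨y, Or.inl ⟨hx, hy⟩, ?_⟩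
    rintro y' (⟨-, h⟩ | ⟨n, -, h, -⟩)
    · exact hyu y' h
    · exact absurd (hx n) h
  · have hx' : ∃ n, ¬ o.IsMaxEdge (x.1 n) := by
      unfold IsMaxPath at hx
      push Not at hx
      exact hx
    obtain ⟨n, hn, hlt⟩ : ∃ n, ¬ o.IsMaxEdge (x.1 n) ∧ ∀ i, i < n → o.IsMaxEdge (x.1 i) :=
      ⟨Nat.find hx', Nat.find_spec hx', fun i hi => not_not.1 (Nat.find_min hx' hi)⟩
    obtain ⟨f, hf⟩ := o.exists_isSucc hn
    obtain ⟨y, hy1, hy2⟩ := o.exists_min_completion n (Function.update x.1 n f) (by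
      intro i hi
      rcases Nat.eq_or_lt_of_le hi with rfl | hlt
      · rw [Function.update_self, Function.update_of_ne (by omega)]
        exact (o.r_eq_of_le hf.1).symm.trans (x.2 n)
      · rw [Function.update_of_ne (by omega), Function.update_of_ne (by omega)]
        exact x.2 i)
    have hyn : y.1 n = f := by rw [hy2 n le_rfl, Function.update_self]
    have hytail : ∀ i, n < i → y.1 i = x.1 i := fun i hi => by
      rw [hy2 i hi.le, Function.update_of_ne (by omega)]
    refine ⟨y, Or.inr ⟨n, hlt, hn, hy1, hyn ▸ hf, hytail⟩, ?_⟩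
    rintro y' (⟨h, -⟩ | ⟨m, hm1, hm2, hm3, hm4, hm5⟩)
    · exact absurd h hx
    · have hmn : m = n := by
        rcases Nat.lt_trichotomy m n with h | h | h
        · exact absurd (hlt m h) hm2
        · exact h
        · exact absurd (hm1 n h) hn
      subst hmn
      have key : ∀ k, k ≤ m → y'.1 (m - k) = y.1 (m - k) := by
        intro k
        induction k with
        | zero => intro _; exact (o.isSucc_unique hm4 hf).trans hyn.symm
        | succ k ih =>
          intro hk
          have h1 := ih (by omega)
          have h2 : m - k = m - (k + 1) + 1 := by omega
          rw [h2] at h1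
          refine o.isMinEdge_unique (hm3 _ (by omega)) (hy1 _ (by omega)) ?_
          rw [y'.2, y.2, h1]
      apply Subtype.ext
      funext i
      rcases Nat.lt_or_ge m i with h | h
      · rw [hm5 i h, hytail i h]
      · have := key (m - i) (by omega)
        rwa [Nat.sub_sub_self h] at this

/-- The Vershik map of a properly ordered Bratteli diagram. -/
noncomputable def vershikMap (o : B.EdgeOrder) (ho : o.IsProperlyOrdered) (x : B.PathSpace) :
    B.PathSpace :=
  (o.existsUnique_vershikRel ho x).choose

/-- Proper Bratteli–Vershik representations: the diagram is properly ordered, and moreover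
(1) the entries of `h_1` are all equal to `1`;
(2) for every `n ≥ 2` the matrix `M_n` has positive entries;
(3) for every `n ≥ 2` all maximal edges of `E_n` start in the same vertex. -/
structure IsProper (o : B.EdgeOrder) : Prop where
  properlyOrdered : o.IsProperlyOrdered
  height_one : ∀ w : B.V 1, B.height 1 w = 1
  incidence_pos : ∀ n, 2 ≤ n + 1 → ∀ u w, 0 < B.incidence n u w
  max_source : ∀ n, 2 ≤ n + 1 → ∀ e f : B.E n, o.IsMaxEdge e → o.IsMaxEdge f → B.s e = B.s f

/-- The local orders of `o` and `o'` at the vertex `w` differ at most `k` times: moving at most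
`k` edges with range `w` turns one order into the other, that is, the two orders coincide on the
edges with range `w` outside some set of at most `k` edges. -/
def DifferAtMost (o o' : B.EdgeOrder) {n : ℕ} (w : B.V (n + 1)) (k : ℕ) : Prop :=
  ∃ F : Finset (B.E n), F.card ≤ k ∧
    ∀ e f : B.E n, B.r e = w → B.r f = w → e ∉ F → f ∉ F → (o.le e f ↔ o'.le e f)

/-- `o'` is an `(ω_n ; n ≥ 2)`-order modification of `o`: for every `n ≥ 2` and every vertex of
`V_n`, the local orders at this vertex differ at most `ω_n` times. -/
def IsOrderModification (ω : ℕ → ℕ) (o o' : B.EdgeOrder) : Prop :=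
  ∀ n, 2 ≤ n + 1 → ∀ w : B.V (n + 1), o.DifferAtMost o' w (ω (n + 1))

end EdgeOrder

end BratteliDiagram

/-- `c` is a continuous eigenvalue of `T : X → X`. -/
def IsContinuousEigenvalue {X : Type*} [TopologicalSpace X] (T : X → X) (c : ℂ) : Prop :=
  ∃ f : X → ℂ, Continuous f ∧ f ≠ 0 ∧ ∀ x, f (T x) = c * f x

/-- The distance of a real vector to the integer vectors: the largest distance of one of its
entries to the nearest integer. -/
noncomputable def distToInt {ι : Type*} [Fintype ι] (a : ι → ℝ) : ℝ :=
  ⨆ i, |a i - round (a i)|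

namespace BratteliDiagram

variable {B : BratteliDiagram.{u, v}}

open Classical in
theorem height_succ (n : ℕ) (w : B.V (n + 1)) :
    B.height (n + 1) w = ∑ e with B.r e = w, B.height n (B.s e) := by
  have h : B.height (n + 1) w = ∑ u, B.height n u * B.incidence n u w := rfl
  rw [h, ← Finset.sum_fiberwise _ B.s]
  refine Finset.sum_congr rfl fun u _ => ?_
  rw [Finset.sum_congr rfl (g := fun _ => B.height n u)
    (fun e he => by rw [(Finset.mem_filter.1 he).2]), Finset.sum_const, smul_eq_mul, mul_comm,
    incidence, Nat.card_eq_fintype_card, Fintype.card_subtype, Finset.filter_filter]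
  simp only [and_comm]

theorem height_pos (n : ℕ) (w : B.V n) : 0 < B.height n w := by
  classical
  induction n with
  | zero => exact Nat.one_pos
  | succ n ih =>
    rw [height_succ]
    obtain ⟨e, he⟩ := B.r_surjective n w
    exact Finset.sum_pos (fun e _ => ih _) ⟨e, by simpa using he⟩

namespace EdgeOrder

/-- The sum of the heights of the sources of the edges greater than `e`. -/
noncomputable def suffixHeight (o : B.EdgeOrder) {n : ℕ} (e : B.E n) : ℕ :=
  open Classical in ∑ f with o.le e f ∧ f ≠ e, B.height n (B.s f)

theorem suffixHeight_eq_zero_iff (o : B.EdgeOrder) {n : ℕ} {e : B.E n} :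
    o.suffixHeight e = 0 ↔ o.IsMaxEdge e := by
  simp only [suffixHeight, Finset.sum_eq_zero_iff, Finset.mem_filter, Finset.mem_univ, true_and,
    (height_pos _ _).ne', imp_false, not_and, not_not]
  rfl

theorem suffixHeight_of_isSucc (o : B.EdgeOrder) {n : ℕ} {e f : B.E n} (h : o.IsSucc e f) :
    o.suffixHeight e = B.height n (B.s f) + o.suffixHeight f := by
  classical
  unfold suffixHeight
  rw [← Finset.sum_insert (f := fun g => B.height n (B.s g)) (a := f) (by simp)]
  refine Finset.sum_congr ?_ fun _ _ => rfl
  ext g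
  simp only [Finset.mem_filter, Finset.mem_univ, true_and, Finset.mem_insert]
  constructor
  · rintro ⟨h1, h2⟩
    by_cases hg : g = f
    · exact Or.inl hg
    · exact Or.inr ⟨h.2.2 g h1 (Ne.symm h2), hg⟩
  · rintro (rfl | ⟨h1, h2⟩)
    · exact ⟨h.1, h.2.1.symm⟩
    · refine ⟨o.le_trans _ _ _ h.1 h1, ?_⟩
      rintro rfl
      exact h2 (o.le_antisymm _ _ h.1 h1)

theorem IsMinEdge.le (o : B.EdgeOrder) {n : ℕ} {e f : B.E n} (h : o.IsMinEdge e)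
    (hr : B.r e = B.r f) : o.le e f := by
  rcases (o.comparable_iff e f).2 hr with h' | h'
  · exact h'
  · rw [h f h']; exact o.le_refl e

theorem height_of_isMinEdge (o : B.EdgeOrder) {n : ℕ} {e : B.E n} (h : o.IsMinEdge e) :
    B.height (n + 1) (B.r e) = B.height n (B.s e) + o.suffixHeight e := by
  classical
  rw [height_succ]
  unfold suffixHeight
  rw [← Finset.sum_insert (f := fun g => B.height n (B.s g)) (a := e) (by simp)]
  refine Finset.sum_congr ?_ fun _ _ => rfl
  ext g
  simp only [Finset.mem_filter, Finset.mem_univ, true_and, Finset.mem_insert]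
  constructor
  · intro hg
    by_cases hge : g = e
    · exact Or.inl hge
    · exact Or.inr ⟨IsMinEdge.le o h hg.symm, hge⟩
  · rintro (rfl | ⟨h1, -⟩)
    · rfl
    · exact (o.r_eq_of_le h1).symm

theorem exists_isMaxEdge (o : B.EdgeOrder) {n : ℕ} (w : B.V (n + 1)) :
    ∃ e : B.E n, B.r e = w ∧ o.IsMaxEdge e := by
  let _ : PartialOrder (B.E n) :=
    { le := o.le, le_refl := o.le_refl, le_trans := o.le_trans, le_antisymm := o.le_antisymm }
  obtain ⟨e, he⟩ := (Set.toFinite {e : B.E n | B.r e = w}).exists_maximal (B.r_surjective n w)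
  exact ⟨e, he.1, fun f hf => o.le_antisymm f e
    (he.2 ((o.r_eq_of_le hf).symm.trans he.1) hf) hf⟩

theorem isMaxEdge_unique (o : B.EdgeOrder) {n : ℕ} {e f : B.E n} (he : o.IsMaxEdge e)
    (hf : o.IsMaxEdge f) (h : B.r e = B.r f) : e = f := by
  rcases (o.comparable_iff e f).2 h with h | h
  · exact (he f h).symm
  · exact hf e h

/-- The number of applications of the Vershik map that make the first `n` edges of `x` maximal. -/
noncomputable def timeToTop (o : B.EdgeOrder) (n : ℕ) (x : B.PathSpace) : ℕ :=
  ∑ i ∈ Finset.range n, o.suffixHeight (x.1 i)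

theorem timeToTop_eq_zero_iff (o : B.EdgeOrder) {n : ℕ} {x : B.PathSpace} :
    o.timeToTop n x = 0 ↔ ∀ i, i < n → o.IsMaxEdge (x.1 i) := by
  simp [timeToTop, suffixHeight_eq_zero_iff]

theorem timeToTop_of_min (o : B.EdgeOrder) {n : ℕ} {x : B.PathSpace}
    (h : ∀ i, i < n → o.IsMinEdge (x.1 i)) :
    o.timeToTop n x + 1 = B.height n (B.s (x.1 n)) := by
  induction n with
  | zero => rfl
  | succ n ih =>
    rw [← x.2 n, height_of_isMinEdge o (h n (by omega)), ← ih fun i hi => h i (by omega),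
      timeToTop, Finset.sum_range_succ, timeToTop]
    omega

theorem timeToTop_vershik (o : B.EdgeOrder) {x y : B.PathSpace} {k n : ℕ} (hkn : k < n)
    (hx : ∀ i, i < k → o.IsMaxEdge (x.1 i)) (hy : ∀ i, i < k → o.IsMinEdge (y.1 i))
    (hs : o.IsSucc (x.1 k) (y.1 k)) (ht : ∀ i, k < i → y.1 i = x.1 i) :
    o.timeToTop n x = o.timeToTop n y + 1 := by
  have key : o.timeToTop (k + 1) x = o.timeToTop (k + 1) y + 1 := by
    have h1 := o.timeToTop_eq_zero_iff.2 hx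
    have h2 := o.timeToTop_of_min hy
    have h3 := o.suffixHeight_of_isSucc hs
    unfold timeToTop at *
    rw [Finset.sum_range_succ, Finset.sum_range_succ]
    omega
  obtain ⟨m, rfl⟩ := Nat.exists_eq_add_of_le (Nat.succ_le_of_lt hkn)
  induction m with
  | zero => exact key
  | succ m ih =>
    have := ih (by omega)
    unfold timeToTop at *
    rw [← add_assoc, Finset.sum_range_succ, Finset.sum_range_succ, this,
      ht (k.succ + m) (by omega)]
    omega

theorem vershikRel_vershikMap (o : B.EdgeOrder) (ho : o.IsProperlyOrdered) (x : B.PathSpace) :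
    o.VershikRel x (o.vershikMap ho x) :=
  (o.existsUnique_vershikRel ho x).choose_spec.1

/-- A path which is not maximal below `n` is moved by the Vershik map within its tower. -/
theorem vershikMap_of_timeToTop (o : B.EdgeOrder) (ho : o.IsProperlyOrdered) {n : ℕ}
    {x : B.PathSpace} (h : o.timeToTop n x ≠ 0) :
    o.timeToTop n x = o.timeToTop n (o.vershikMap ho x) + 1 ∧
      ∀ i, n ≤ i → (o.vershikMap ho x).1 i = x.1 i := by
  rcases o.vershikRel_vershikMap ho x with ⟨hx, -⟩ | ⟨k, h1, h2, h3, h4, h5⟩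
  · exact absurd (o.timeToTop_eq_zero_iff.2 fun i _ => hx i) h
  · have hk : k < n := by
      by_contra hk
      exact h (o.timeToTop_eq_zero_iff.2 fun i hi => h1 i (by omega))
    exact ⟨o.timeToTop_vershik hk h1 h3 h4 h5, fun i hi => h5 i (by omega)⟩

theorem exists_top_of_eigenfunction (o : B.EdgeOrder) (ho : o.IsProperlyOrdered) {c : ℂ}
    {f : B.PathSpace → ℂ} (hf : ∀ x, f (o.vershikMap ho x) = c * f x) (n : ℕ)
    (x : B.PathSpace) :
    ∃ y : B.PathSpace, (∀ i, i < n → o.IsMaxEdge (y.1 i)) ∧ (∀ i, n ≤ i → y.1 i = x.1 i) ∧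
      f y = c ^ o.timeToTop n x * f x := by
  induction hk : o.timeToTop n x generalizing x with
  | zero => exact ⟨x, o.timeToTop_eq_zero_iff.1 hk, fun _ _ => rfl, by simp⟩
  | succ k ih =>
    obtain ⟨h1, h2⟩ := o.vershikMap_of_timeToTop ho (n := n) (x := x) (by omega)
    obtain ⟨y, hy1, hy2, hy3⟩ := ih (o.vershikMap ho x) (by omega)
    exact ⟨y, hy1, fun i hi => (hy2 i hi).trans (h2 i hi), by rw [hy3, hf, pow_succ]; ring⟩

theorem IsProper.eq_of_isMaxPath (o : B.EdgeOrder) (ho : o.IsProper) {x y : B.PathSpace} {n : ℕ}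
    (hx : ∀ i, i < n + 1 → o.IsMaxEdge (x.1 i)) (hy : ∀ i, i < n + 1 → o.IsMaxEdge (y.1 i))
    {i : ℕ} (hi : i < n) : x.1 i = y.1 i := by
  refine o.isMaxEdge_unique (hx i (by omega)) (hy i (by omega)) ?_
  rw [x.2, y.2]
  exact ho.max_source (i + 1) (by omega) _ _ (hx _ (by omega)) (hy _ (by omega))

end EdgeOrder

theorem PathSpace.tendsto_of_eventually_eq {y : ℕ → B.PathSpace} {x : B.PathSpace}
    (h : ∀ i, ∀ᶠ n in Filter.atTop, (y n).1 i = x.1 i) :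
    Filter.Tendsto y Filter.atTop (nhds x) := by
  let _ (i : ℕ) : TopologicalSpace (B.E i) := ⊥
  rw [nhds_induced, Filter.tendsto_comap_iff, tendsto_pi_nhds]
  exact fun i => tendsto_nhds_of_eventually_eq (h i)

theorem PathSpace.continuous_coord {Y : Type*} [TopologicalSpace Y] (i : ℕ) (g : B.E i → Y) :
    Continuous fun x : B.PathSpace => g (x.1 i) := by
  let _ (i : ℕ) : TopologicalSpace (B.E i) := ⊥
  have : DiscreteTopology (B.E i) := ⟨rfl⟩
  exact (continuous_of_discreteTopology (f := g)).comp
    ((continuous_apply i).comp continuous_induced_dom)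

end BratteliDiagram

/-- Nonnegative reals at most `1 / 2` with all partial sums close to `ℤ` are summable. -/
theorem summable_of_norm_sum_le {a : ℕ → ℝ} (h0 : ∀ i, 0 ≤ a i) (h1 : ∀ i, a i ≤ 1 / 2) {m : ℕ}
    (h : ∀ N, m ≤ N → ‖∑ i ∈ Finset.Ico m N, (a i : UnitAddCircle)‖ ≤ 1 / 10) : Summable a := by
  have habs {t : ℝ} (ht : |t| ≤ 1 / 2) : ‖(t : UnitAddCircle)‖ = |t| :=
    (AddCircle.norm_coe_eq_abs_iff (p := 1) one_ne_zero).2 (by simpa using ht)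
  have hcoe (N : ℕ) : ∑ i ∈ Finset.Ico m N, (a i : UnitAddCircle) =
      ((∑ i ∈ Finset.Ico m N, a i : ℝ) : UnitAddCircle) :=
    (map_sum (QuotientAddGroup.mk' (AddSubgroup.zmultiples (1 : ℝ))) a _).symm
  have hstep (N : ℕ) (hN : m ≤ N) : a N ≤ 1 / 5 := by
    have h2 := habs (t := a N) (by rw [abs_of_nonneg (h0 N)]; exact h1 N)
    rw [abs_of_nonneg (h0 N)] at h2
    have h3 := h (N + 1) (by omega)
    rw [Finset.sum_Ico_succ_top hN] at h3
    have h4 := norm_sub_le (∑ i ∈ Finset.Ico m N, (a i : UnitAddCircle) + (a N : UnitAddCircle))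
      (∑ i ∈ Finset.Ico m N, (a i : UnitAddCircle))
    rw [add_sub_cancel_left, h2] at h4
    linarith [h N hN]
  have hsum (k : ℕ) : ∑ i ∈ Finset.Ico m (m + k), a i ≤ 1 / 10 := by
    induction k with
    | zero => simp
    | succ k ih =>
      have h2 := h (m + (k + 1)) (by omega)
      have h3 := hstep (m + k) (by omega)
      have h5 : ∑ i ∈ Finset.Ico m (m + (k + 1)), a i =
          ∑ i ∈ Finset.Ico m (m + k), a i + a (m + k) :=
        Finset.sum_Ico_succ_top (Nat.le_add_right m k) _
      have h4 : 0 ≤ ∑ i ∈ Finset.Ico m (m + (k + 1)), a i := Finset.sum_nonneg fun i _ => h0 i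
      rwa [hcoe, habs (by rw [abs_of_nonneg h4]; linarith), abs_of_nonneg h4] at h2
  refine (summable_nat_add_iff m).1 (summable_of_sum_range_le (c := 1 / 10) (fun i => h0 _) ?_)
  intro k
  have := hsum k
  rw [Finset.sum_Ico_eq_sum_range] at this
  simpa [add_comm] using this

theorem exists_norm_lt_of_toCircle {ε : ℝ} (hε : 0 < ε) :
    ∃ δ > 0, ∀ z : UnitAddCircle, ‖(z.toCircle : ℂ) - 1‖ < δ → ‖z‖ < ε := by
  have h := (AddCircle.homeomorphCircle (T := 1) one_ne_zero).symm.continuous.continuousAt (x := 1)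
  obtain ⟨δ, hδ, H⟩ := Metric.continuousAt_iff.1 h ε hε
  have h1 : (AddCircle.homeomorphCircle (T := 1) one_ne_zero).symm 1 = 0 := by
    rw [Homeomorph.symm_apply_eq, AddCircle.homeomorphCircle_apply, AddCircle.toCircle_zero]
  refine ⟨δ, hδ, fun z hz => ?_⟩
  have := @H z.toCircle (by rwa [← dist_eq_norm] at hz)
  rwa [h1, ← AddCircle.homeomorphCircle_apply (T := 1) one_ne_zero, Homeomorph.symm_apply_apply,
    dist_zero_right] at this

theorem exists_lift_norm (z : UnitAddCircle) : ∃ t : ℝ, (t : UnitAddCircle) = z ∧ |t| = ‖z‖ := by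
  obtain ⟨x, rfl⟩ := QuotientAddGroup.mk_surjective z
  refine ⟨x - round x, ?_, UnitAddCircle.norm_eq.symm⟩
  rw [AddCircle.coe_sub, sub_eq_self]
  exact (AddCircle.coe_eq_zero_iff 1).2 ⟨round x, by simp⟩

/-- If all sums of a choice of elements of the sets `θ i` over a window are small modulo `1`,
then the largest norms are summable. -/
theorem summable_norm_of_choices {E : ℕ → Type*} (θ : ∀ i, E i → UnitAddCircle)
    (z : ∀ i, E i) (hz : ∀ i, θ i (z i) = 0) {m : ℕ}
    (h : ∀ (e : ∀ i, E i) N, m ≤ N → ‖∑ i ∈ Finset.Ico m N, θ i (e i)‖ ≤ 1 / 10) (e : ∀ i, E i) :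
    Summable fun i => ‖θ i (e i)‖ := by
  classical
  choose t ht ht' using fun i => exists_lift_norm (θ i (e i))
  have hle (i : ℕ) : |t i| ≤ 1 / 2 := by
    rw [ht']
    simpa using AddCircle.norm_le_half_period (p := 1) one_ne_zero (x := θ i (e i))
  have hpos : Summable fun i => max (t i) 0 := by
    refine summable_of_norm_sum_le (m := m) (fun i => le_max_right _ _)
      (fun i => max_le ((le_abs_self _).trans (hle i)) (by norm_num)) fun N hN => ?_
    refine le_of_eq_of_le ?_ (h (fun i => if 0 ≤ t i then e i else z i) N hN)
    congr 1
    refine Finset.sum_congr rfl fun i _ => ?_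
    split_ifs with hi
    · rw [max_eq_left hi, ht]
    · rw [max_eq_right (by linarith), hz, AddCircle.coe_zero]
  have hneg : Summable fun i => max (-t i) 0 := by
    refine summable_of_norm_sum_le (m := m) (fun i => le_max_right _ _)
      (fun i => max_le ((neg_le_abs _).trans (hle i)) (by norm_num)) fun N hN => ?_
    refine le_of_eq_of_le ?_ (h (fun i => if t i ≤ 0 then e i else z i) N hN)
    rw [← norm_neg, ← Finset.sum_neg_distrib]
    congr 1
    refine Finset.sum_congr rfl fun i _ => ?_
    split_ifs with hi
    · rw [max_eq_left (by linarith), AddCircle.coe_neg, neg_neg, ht]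
    · rw [max_eq_right (by linarith), hz, AddCircle.coe_zero, neg_zero]
  refine (hpos.add hneg).congr fun i => ?_
  rw [← ht', max_comm, max_comm (-t i)]
  rcases le_total 0 (t i) with hi | hi
  · rw [abs_of_nonneg hi, max_eq_right hi, max_eq_left (by linarith), add_zero]
  · rw [abs_of_nonpos hi, max_eq_left hi, max_eq_right (by linarith), zero_add]

namespace BratteliDiagram

variable {B : BratteliDiagram.{u, v}}

namespace EdgeOrder

theorem IsProper.exists_eigenfunction_close (o : B.EdgeOrder) (ho : o.IsProper)
    {f : B.PathSpace → ℂ} (hf : Continuous f) {x : B.PathSpace} (hx : o.IsMaxPath x) {η : ℝ}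
    (hη : 0 < η) :
    ∃ m, ∀ y : B.PathSpace, (∀ i, i < m → o.IsMaxEdge (y.1 i)) → ‖f y - f x‖ < η := by
  by_contra! hcon
  choose y hy hy' using hcon
  have hlim : Filter.Tendsto y Filter.atTop (nhds x) := by
    refine PathSpace.tendsto_of_eventually_eq fun i => ?_
    filter_upwards [Filter.eventually_ge_atTop (i + 2)] with n hn
    exact ho.eq_of_isMaxPath (n := i + 1) o (fun j hj => hy n j (by omega)) (fun j _ => hx j)
      (by omega)
  obtain ⟨n, hn⟩ := (Metric.tendsto_nhds.1 ((hf.tendsto x).comp hlim) η hη).exists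
  rw [dist_eq_norm] at hn
  exact absurd hn (not_lt.2 (hy' n))

theorem IsProper.exists_norm_sum_lt (o : B.EdgeOrder) (ho : o.IsProper) {a : UnitAddCircle}
    (ha : IsContinuousEigenvalue (o.vershikMap ho.properlyOrdered) (a.toCircle : ℂ)) {ε : ℝ}
    (hε : 0 < ε) :
    ∃ m, ∀ N, m ≤ N → ∀ x : B.PathSpace,
      ‖∑ i ∈ Finset.Ico m N, o.suffixHeight (x.1 i) • a‖ < ε := by
  obtain ⟨f, hf, hf0, hfe⟩ := ha
  obtain ⟨x₀, hx₀, -⟩ := ho.properlyOrdered.1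
  have htop := o.exists_top_of_eigenfunction ho.properlyOrdered hfe
  have hc : f x₀ ≠ 0 := by
    intro hc
    obtain ⟨x, hx⟩ := Function.ne_iff.1 hf0
    obtain ⟨m, hm⟩ := ho.exists_eigenfunction_close o hf hx₀ (norm_pos_iff.2 hx)
    obtain ⟨y, hy, -, hyf⟩ := htop m x
    have := hm y hy
    rw [hc, sub_zero, hyf, norm_mul, norm_pow, Circle.norm_coe, one_pow, one_mul] at this
    exact lt_irrefl _ this
  have hc' := norm_pos_iff.2 hc
  obtain ⟨δ, hδ, H⟩ := exists_norm_lt_of_toCircle hε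
  obtain ⟨m, hm⟩ := ho.exists_eigenfunction_close o hf hx₀
    (η := min (‖f x₀‖ / 2) (δ * ‖f x₀‖ / 4)) (by positivity)
  refine ⟨m, fun N hN x => H _ ?_⟩
  obtain ⟨y, hy, -, hyf⟩ := htop m x
  obtain ⟨y', hy', -, hyf'⟩ := htop N x
  have h1 := hm y hy
  have h2 := hm y' fun i hi => hy' i (by omega)
  have hsum : o.timeToTop N x = o.timeToTop m x + ∑ i ∈ Finset.Ico m N, o.suffixHeight (x.1 i) :=
    (Finset.sum_range_add_sum_Ico _ hN).symm
  rw [Finset.sum_nsmul_assoc, AddCircle.toCircle_nsmul, Circle.coe_pow]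
  have h3 : f y' - f y =
      ((a.toCircle : ℂ) ^ (∑ i ∈ Finset.Ico m N, o.suffixHeight (x.1 i)) - 1) * f y := by
    rw [hyf', hyf, hsum, pow_add]
    ring
  have h4 : ‖f y' - f y‖ < δ * ‖f x₀‖ / 2 := by
    have h5 : f y' - f y = (f y' - f x₀) - (f y - f x₀) := by ring
    rw [h5]
    linarith [norm_sub_le (f y' - f x₀) (f y - f x₀), min_le_right (‖f x₀‖ / 2) (δ * ‖f x₀‖ / 4)]
  have h5 : ‖f x₀‖ / 2 < ‖f y‖ := by
    linarith [norm_sub_norm_le (f x₀) (f y), norm_sub_rev (f x₀) (f y),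
      min_le_left (‖f x₀‖ / 2) (δ * ‖f x₀‖ / 4)]
  rw [h3, norm_mul] at h4
  by_contra! hcon
  nlinarith [mul_le_mul hcon h5.le (by positivity) (norm_nonneg _)]

end EdgeOrder

end BratteliDiagram

namespace BratteliDiagram

variable {B : BratteliDiagram.{u, v}}

namespace EdgeOrder

/-- Arbitrary edges at every third level lie on a path, and replacing all of them by maximal edges
gives a path with the same suffix heights at the other levels. -/
theorem IsProper.exists_interpolating_paths (o : B.EdgeOrder) (ho : o.IsProper) (d : ℕ)
    (e : ∀ n, B.E n) :
    ∃ x y : B.PathSpace, ∀ n,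
      ((n + d) % 3 = 0 → x.1 n = e n ∧ o.suffixHeight (y.1 n) = 0) ∧
      ((n + d) % 3 ≠ 0 → o.suffixHeight (x.1 n) = o.suffixHeight (y.1 n)) := by
  choose M hM hM' using fun n w => o.exists_isMaxEdge (n := n) w
  obtain ⟨t, ht⟩ : ∃ t : ∀ n, B.V (n + 1), ∀ n (e : B.E (n + 1)), o.IsMaxEdge e → B.s e = t n :=
    ⟨fun n => B.s (M (n + 1) (B.r (e (n + 1)))),
      fun n f hf => ho.max_source (n + 1) (by omega) _ _ hf (hM' _ _)⟩
  have hG (n : ℕ) (u : B.V (n + 1)) : ∃ g : B.E (n + 1), B.s g = u ∧ B.r g = t (n + 1) := by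
    obtain ⟨g⟩ := (Nat.card_pos_iff.1 (ho.incidence_pos (n + 1) (by omega) u (t (n + 1)))).1
    exact ⟨g.1, g.2⟩
  choose G hG hG' using hG
  let p (e : ∀ n, B.E n) : ∀ n, B.E n := fun n => match n with
    | 0 => if (0 + d) % 3 = 0 then e 0 else if (0 + d) % 3 = 1 then M 0 (t 0) else M 0 (B.s (e 1))
    | n + 1 => if (n + 1 + d) % 3 = 0 then e (n + 1) else
        if (n + 1 + d) % 3 = 1 then G n (B.r (e n)) else M (n + 1) (B.s (e (n + 2)))
  have p0 (e : ∀ n, B.E n) (n : ℕ) (h : (n + d) % 3 = 0) : p e n = e n := by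
    cases n <;> simp only [p, if_pos h]
  have p1 (e : ∀ n, B.E n) (n : ℕ) (h : (n + d) % 3 = 1) : B.r (p e n) = t n := by
    cases n
    · simp only [p, h, if_neg one_ne_zero, if_true, hM]
    · simp only [p, h, if_neg one_ne_zero, if_true, hG']
  have p1' (e : ∀ n, B.E n) (n : ℕ) (h : (n + 1 + d) % 3 = 1) :
      p e (n + 1) = G n (B.r (e n)) := by
    simp only [p, h, if_neg one_ne_zero, if_true]
  have p2 (e : ∀ n, B.E n) (n : ℕ) (h : (n + d) % 3 = 2) : p e n = M n (B.s (e (n + 1))) := by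
    have h0 : (2 : ℕ) ≠ 0 := two_ne_zero
    have h1 : (2 : ℕ) ≠ 1 := by decide
    cases n <;> simp only [p, h, if_neg h0, if_neg h1]
  have hp (e : ∀ n, B.E n) (n : ℕ) : B.r (p e n) = B.s (p e (n + 1)) := by
    have h3 : (n + d) % 3 = 0 ∨ (n + d) % 3 = 1 ∨ (n + d) % 3 = 2 := by omega
    rcases h3 with h | h | h
    · rw [p0 e n h, p1' e n (by omega), hG]
    · rw [p1 e n h, p2 e (n + 1) (by omega), ht n _ (hM' _ _)]
    · rw [p2 e n h, p0 e (n + 1) (by omega), hM]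
  let e' : ∀ n, B.E n := fun n => M n (B.r (e n))
  have hmax (n : ℕ) (w : B.V (n + 1)) := o.suffixHeight_eq_zero_iff.2 (hM' n w)
  refine ⟨⟨p e, hp e⟩, ⟨p e', hp e'⟩, fun n => ⟨fun h => ⟨p0 e n h, ?_⟩, fun h => ?_⟩⟩
  · change o.suffixHeight (p e' n) = 0
    rw [p0 e' n h, hmax]
  · change o.suffixHeight (p e n) = o.suffixHeight (p e' n)
    have h3 : (n + d) % 3 = 1 ∨ (n + d) % 3 = 2 := by omega
    rcases h3 with h | h
    · cases n with
      | zero => simp only [p, h, if_neg one_ne_zero, if_true]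
      | succ n => rw [p1' e n h, p1' e' n h, hM]
    · rw [p2 e n h, p2 e' n h, hmax, hmax]

/-- For a continuous eigenvalue of a proper representation, the suffix heights of arbitrary edges
are summably close to integers after multiplication by the angle. -/
theorem IsProper.summable_norm_suffixHeight (o : B.EdgeOrder) (ho : o.IsProper)
    {a : UnitAddCircle}
    (ha : IsContinuousEigenvalue (o.vershikMap ho.properlyOrdered) (a.toCircle : ℂ))
    (e : ∀ n, B.E n) : Summable fun n => ‖o.suffixHeight (e n) • a‖ := by
  choose M hM hM' using fun n w => o.exists_isMaxEdge (n := n) w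
  obtain ⟨m, hm⟩ := ho.exists_norm_sum_lt o ha (ε := 1 / 20) (by norm_num)
  have key (d : ℕ) :
      Summable fun n => ‖if (n + d) % 3 = 0 then o.suffixHeight (e n) • a else 0‖ := by
    refine summable_norm_of_choices (E := B.E)
      (fun n f => if (n + d) % 3 = 0 then o.suffixHeight f • a else 0)
      (fun n => M n (B.r (e n))) (fun n => ?_) (m := m) (fun f N hN => ?_) e
    · simp [o.suffixHeight_eq_zero_iff.2 (hM' _ _)]
    · obtain ⟨x, y, hxy⟩ := ho.exists_interpolating_paths o d f
      have h1 : ∑ i ∈ Finset.Ico m N, (if (i + d) % 3 = 0 then o.suffixHeight (f i) • a else 0) =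
          ∑ i ∈ Finset.Ico m N, o.suffixHeight (x.1 i) • a -
            ∑ i ∈ Finset.Ico m N, o.suffixHeight (y.1 i) • a := by
        rw [← Finset.sum_sub_distrib]
        refine Finset.sum_congr rfl fun i _ => ?_
        split_ifs with h
        · rw [((hxy i).1 h).1, ((hxy i).1 h).2, zero_nsmul, sub_zero]
        · rw [(hxy i).2 h, sub_self]
      rw [h1]
      linarith [norm_sub_le (∑ i ∈ Finset.Ico m N, o.suffixHeight (x.1 i) • a)
        (∑ i ∈ Finset.Ico m N, o.suffixHeight (y.1 i) • a), hm N hN x, hm N hN y]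
  refine (((key 0).add (key 1)).add (key 2)).congr fun n => ?_
  have h3 : n % 3 = 0 ∨ n % 3 = 1 ∨ n % 3 = 2 := by omega
  rcases h3 with h | h | h <;> simp [h, Nat.add_mod]

theorem sum_height_nsmul_norm_le {n : ℕ} (a : UnitAddCircle) {c : ℝ}
    (hc : ∀ w : B.V n, ‖B.height n w • a‖ ≤ c) (F : Finset (B.E n)) :
    ‖∑ f ∈ F, B.height n (B.s f) • a‖ ≤ F.card * c := by
  rw [← nsmul_eq_mul]
  exact Finset.sum_le_card_nsmul F _ c (fun f _ => hc _) |> (norm_sum_le _ _).trans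

/-- Moving at most `k` edges in the local orders changes the suffix heights, up to a replacement of
the edge, by at most `2 k + 1` heights. -/
theorem DifferAtMost.exists_norm_suffixHeight_le {o o' : B.EdgeOrder} {n : ℕ} (e : B.E n) {k : ℕ}
    (h : o.DifferAtMost o' (B.r e) k) (a : UnitAddCircle) {c : ℝ} (hc0 : 0 ≤ c)
    (hc : ∀ w : B.V n, ‖B.height n w • a‖ ≤ c) :
    ∃ e' : B.E n, ‖o'.suffixHeight e • a‖ ≤ ‖o.suffixHeight e' • a‖ + (2 * k + 1) * c := by
  classical
  obtain ⟨F, hF, H⟩ := h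
  have hsub (T : Finset (B.E n)) :
      ‖∑ f ∈ T with f ∈ F, B.height n (B.s f) • a‖ ≤ k * c := by
    refine (sum_height_nsmul_norm_le a hc _).trans (mul_le_mul_of_nonneg_right ?_ hc0)
    exact_mod_cast (Finset.card_le_card fun f hf => (Finset.mem_filter.1 hf).2).trans hF
  have hS (o : B.EdgeOrder) (e : B.E n) : o.suffixHeight e • a =
      ∑ f with o.le e f ∧ f ≠ e, B.height n (B.s f) • a := by
    rw [suffixHeight, Finset.sum_nsmul_assoc]
  set A : Finset (B.E n) := {f | o'.le e f ∧ f ≠ e} with hA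
  have hsplit := Finset.sum_filter_add_sum_filter_not A (· ∈ F) fun f => B.height n (B.s f) • a
  have hrA {f : B.E n} (hf : f ∈ A) : B.r f = B.r e :=
    (o'.r_eq_of_le (Finset.mem_filter.1 hf).2.1).symm
  by_cases hne : (A.filter (· ∉ F)).Nonempty
  · obtain ⟨g, hg, hgl⟩ := o.exists_least (B.r e) (A.filter (· ∉ F)) hne
      fun f hf => hrA (Finset.mem_filter.1 hf).1
    simp only [Finset.coe_filter, Set.mem_ofPred_eq] at hg hgl
    have hrg := hrA hg.1
    have hg' := (Finset.mem_filter.1 hg.1).2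
    refine ⟨g, ?_⟩
    set C : Finset (B.E n) := {f | o.le g f ∧ f ≠ g} with hC
    have hCg : g ∉ C := by simp [hC]
    have hsplit' := Finset.sum_filter_add_sum_filter_not (insert g C) (· ∈ F)
      fun f => B.height n (B.s f) • a
    have heq : A.filter (· ∉ F) = (insert g C).filter (· ∉ F) := by
      ext f
      simp only [Finset.mem_filter, Finset.mem_insert]
      refine and_congr_left fun hfF => ⟨fun hf => ?_, ?_⟩
      · by_cases hfg : f = g
        · exact Or.inl hfg
        · exact Or.inr (by simpa [hC] using ⟨hgl f ⟨hf, hfF⟩, hfg⟩)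
      · rintro (rfl | hf)
        · exact hg.1
        · have hf' := (Finset.mem_filter.1 hf).2
          have hle := (H g f hrg ((o.r_eq_of_le hf'.1).symm.trans hrg) hg.2 hfF).1 hf'.1
          refine Finset.mem_filter.2 ⟨Finset.mem_univ _, o'.le_trans _ _ _ hg'.1 hle, ?_⟩
          rintro rfl
          exact hg'.2 (o'.le_antisymm _ _ hle hg'.1)
    rw [Finset.sum_insert hCg, ← heq, ← hS] at hsplit'
    have h1 : o'.suffixHeight e • a = o.suffixHeight g • a + B.height n (B.s g) • a +
        ∑ f ∈ A with f ∈ F, B.height n (B.s f) • a -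
        ∑ f ∈ insert g C with f ∈ F, B.height n (B.s f) • a := by
      rw [hS, ← hsplit, add_comm (o.suffixHeight g • a), ← hsplit']
      abel
    rw [h1]
    refine (norm_sub_le _ _).trans ?_
    linarith [hsub A, hsub (insert g C), hc (B.s g),
      norm_add₃_le (a := o.suffixHeight g • a) (b := B.height n (B.s g) • a)
        (c := ∑ f ∈ A with f ∈ F, B.height n (B.s f) • a)]
  · refine ⟨e, ?_⟩
    rw [Finset.not_nonempty_iff_eq_empty.1 hne, Finset.sum_empty, add_zero] at hsplit
    rw [hS o' e, ← hsplit]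
    have : (0 : ℝ) ≤ k * c := by positivity
    linarith [hsub A, norm_nonneg (o.suffixHeight e • a)]

/-- If suffix heights are summably close to integers after multiplication by the angle, and the
heights tend to integers, then the angle defines a continuous eigenvalue. -/
theorem isContinuousEigenvalue_of_summable (o : B.EdgeOrder) (ho : o.IsProperlyOrdered)
    {a : UnitAddCircle} (hs : ∀ e : ∀ n, B.E n, Summable fun n => ‖o.suffixHeight (e n) • a‖)
    (hh : ∀ w : ∀ n, B.V n, Filter.Tendsto (fun n => B.height n (w n) • a) Filter.atTop (nhds 0)) :
    IsContinuousEigenvalue (o.vershikMap ho) (a.toCircle : ℂ) := by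
  obtain ⟨x₀, hx₀, -⟩ := ho.1
  have hmax (n : ℕ) : ∃ e : B.E n, ∀ f : B.E n,
      ‖o.suffixHeight f • a‖ ≤ ‖o.suffixHeight e • a‖ :=
    haveI : Nonempty (B.E n) := ⟨x₀.1 n⟩
    Finite.exists_max _
  choose e he using hmax
  let φ : B.PathSpace → UnitAddCircle := fun x => ∑' n, o.suffixHeight (x.1 n) • a
  have hφ : Continuous φ :=
    continuous_tsum (fun n => PathSpace.continuous_coord n fun f => o.suffixHeight f • a) (hs e)
      fun n x => he n _
  have hlim (x : B.PathSpace) :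
      Filter.Tendsto (fun n => o.timeToTop n x • a) Filter.atTop (nhds (φ x)) := by
    have := (hs x.1).of_norm.hasSum.tendsto_sum_nat
    simpa only [Finset.sum_nsmul_assoc, timeToTop, φ] using this
  have hstep (x : B.PathSpace) : φ x = φ (o.vershikMap ho x) + a := by
    rcases o.vershikRel_vershikMap ho x with ⟨hx, hy⟩ | ⟨k, h1, h2, h3, h4, h5⟩
    · have hx' : φ x = 0 := by
        simp only [φ, o.suffixHeight_eq_zero_iff.2 (hx _), zero_nsmul, tsum_zero]
      have h := (hlim (o.vershikMap ho x)).add_const a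
      simp only [← succ_nsmul, o.timeToTop_of_min fun i _ => hy i] at h
      rw [hx']
      exact tendsto_nhds_unique (hh fun n => B.s ((o.vershikMap ho x).1 n)) h
    · refine tendsto_nhds_unique (hlim x)
        (((hlim (o.vershikMap ho x)).add_const a).congr' ?_)
      filter_upwards [Filter.eventually_gt_atTop k] with n hn
      rw [o.timeToTop_vershik hn h1 h3 h4 h5, succ_nsmul]
  refine ⟨fun x => ((-φ x).toCircle : ℂ),
    continuous_subtype_val.comp (AddCircle.continuous_toCircle.comp hφ.neg),
    fun h => Circle.coe_ne_zero _ (congrFun h x₀), fun x => ?_⟩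
  have h : -φ (o.vershikMap ho x) = a + -φ x := by rw [hstep x]; abel
  change ((-φ (o.vershikMap ho x)).toCircle : ℂ) = a.toCircle * (-φ x).toCircle
  rw [h, AddCircle.toCircle_add, Circle.coe_mul]

end EdgeOrder

end BratteliDiagram

theorem norm_nsmul_le_distToInt {ι : Type*} [Fintype ι] (h : ι → ℕ) (α : ℝ) (i : ι) :
    ‖h i • (α : UnitAddCircle)‖ ≤ distToInt fun i => α * (h i : ℝ) := by
  rw [← AddCircle.coe_nsmul, UnitAddCircle.norm_eq, nsmul_eq_mul, mul_comm]
  exact le_ciSup (f := fun i => |α * (h i : ℝ) - round (α * (h i : ℝ))|)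
    (Set.finite_range _).bddAbove i

theorem distToInt_nonneg {ι : Type*} [Fintype ι] (a : ι → ℝ) : 0 ≤ distToInt a :=
  Real.iSup_nonneg fun _ => abs_nonneg _

theorem mainTheorem5 (B : BratteliDiagram.{u, v}) (o : B.EdgeOrder) (ho : o.IsProper)
    (α : ℝ)
    (hα : IsContinuousEigenvalue (o.vershikMap ho.properlyOrdered)
      (Complex.exp (2 * Complex.I * Real.pi * α)))
    (ω : ℕ → ℕ) (hω : ∀ n, 2 ≤ n → 0 < ω n)
    (hsum : Summable fun n : {n : ℕ // 2 ≤ n} =>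
      (ω (n.1 + 1) : ℝ) * distToInt fun w : B.V n.1 => α * (B.height n.1 w : ℝ))
    (o' : B.EdgeOrder) (ho' : o'.IsProper) (hmod : o.IsOrderModification ω o') :
    IsContinuousEigenvalue (o'.vershikMap ho'.properlyOrdered)
      (Complex.exp (2 * Complex.I * Real.pi * α)) := by
  have hexp : Complex.exp (2 * Complex.I * Real.pi * α) =
      (AddCircle.toCircle (α : UnitAddCircle) : ℂ) := by
    rw [AddCircle.toCircle_apply_mk, Circle.coe_exp]
    push_cast
    congr 1
    ring
  rw [hexp] at hα ⊢
  set D : ℕ → ℝ := fun n => distToInt fun w : B.V n => α * (B.height n w : ℝ) with hD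
  have hD0 (n : ℕ) : 0 ≤ D n := distToInt_nonneg _
  have hDh (n : ℕ) (w : B.V n) : ‖B.height n w • (α : UnitAddCircle)‖ ≤ D n :=
    norm_nsmul_le_distToInt (B.height n) α w
  have hω1 (n : ℕ) : (1 : ℝ) ≤ ω (n + 2 + 1) := by exact_mod_cast hω (n + 2 + 1) (by omega)
  have hsum' : Summable fun n => (ω (n + 2 + 1) : ℝ) * D (n + 2) :=
    hsum.comp_injective (i := fun n => (⟨n + 2, by omega⟩ : {n : ℕ // 2 ≤ n}))
      fun m n h => by simpa using congrArg Subtype.val h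
  refine o'.isContinuousEigenvalue_of_summable ho'.properlyOrdered (fun e => ?_) fun w => ?_
  · choose e' he' using fun n => (hmod (n + 2) (by omega) (B.r (e (n + 2)))).exists_norm_suffixHeight_le
      (e (n + 2)) (α : UnitAddCircle) (hD0 (n + 2)) (hDh (n + 2))
    have hs := (summable_nat_add_iff 2).2 (ho.summable_norm_suffixHeight o hα fun n => match n with
      | 0 => e 0
      | 1 => e 1
      | n + 2 => e' n)
    refine (summable_nat_add_iff 2).1 (Summable.of_nonneg_of_le (fun n => norm_nonneg _)
      (fun n => ?_) (hs.add (hsum'.mul_left 3)))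
    refine (he' n).trans (add_le_add_right ?_ _)
    nlinarith [hω1 n, hD0 (n + 2)]
  · refine squeeze_zero_norm (fun n => hDh n (w n)) ((Filter.tendsto_add_atTop_iff_nat 2).1 ?_)
    exact squeeze_zero (fun n => hD0 _) (fun n => by nlinarith [hω1 n, hD0 (n + 2)])
      hsum'.tendsto_atTop_zero
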